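/- Let $f:\mathbb{R}^{\bar n}\times\mathbb{R}^p\to\mathbb{R}^{\bar n}$ be smooth, and let $\mathcal V=L^\infty([0,1],\mathbb{R}^p)$. Assume that for every $u\in\mathcal V$ and every $x_0\in\mathbb{R}^{\bar n}$ the equation $\dot x(t)=f(x(t),u(t))$, $x(0)=x_0$, has a (Carathéodory) solution on $[0,1]$; write $\varphi(u,x_0)=x(1)$. Let $R:\mathbb{R}^{\bar n}\to\mathbb{R}^{n_o}$ be linear, surjective and $1$-Lipschitz, and let $E:\mathbb{R}^{n}\to\mathbb{R}^{\bar n}$ be continuous and injective (for instance $E(x)=(x,0,\dots,0)$). For $z\in\mathbb{R}^{\bar n}$ and $y\in\mathbb{R}^{n_o}$ put $U(z,y)=\{u\in\mathcal V:\ R(\varphi(u,z))=y\}$. Let $x^1,\dots,x^q\in\mathbb{R}^n$ be pairwise distinct, and let $y^1,\dots,y^q\in\mathbb{R}^{n_o}$. Assume the following. (A1) The $q$-folded system is bracket-generating: at every point $(z_1,\dots,z_q)\in(\mathbb{R}^{\bar n})^q$ with pairwise distinct $z_i$, the Lie algebra generated by the vector fields $(z_1,\dots,z_q)\mapsto(f(z_1,a),\dots,f(z_q,a))$,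 $a\in\mathbb{R}^p$, spans $(\mathbb{R}^{\bar n})^q$. (A2) Linearized controllability at every training point: for every $i$ and every $u\in U(E(x^i),y^i)$, with $x(\cdot)$ the trajectory of $u$ starting at $E(x^i)$, the linear time-varying system $\dot z(t)=\frac{\partial f}{\partial x}(x(t),u(t))\,z(t)+\frac{\partial f}{\partial u}(x(t),u(t))\,v(t)$ with inputs $v\in\mathcal V$ can be steered on $[0,1]$ from any $z(0)\in\mathbb{R}^{\bar n}$ to any $z(1)\in\mathbb{R}^{\bar n}$. (A3) Strong memorization property of degree $q$: for all pairwise distinct $z^1,\dots,z^q\in\mathbb{R}^{\bar n}$ and all $w^1,\dots,w^q\in\mathbb{R}^{n_o}$, the sets $U_i=U(z^i,w^i)$ have a common point and intersect transversally, that is, $T_uU_i+\bigcap_{k\neq i}T_uU_k=\mathcal V$ for every $u\in\bigcap_kU_k$ and every $i$. Here $T_uM$ denotes the linear span of the velocities at $u$ of curves in $M$ through $u$ (the usual tangent space when $M$ is a submanifold). Then for every $1\le j\le q$ the set $\bigcap_{i=1}^{j}U(E(x^i),y^i)$ is a smooth Banach submanifold of $\mathcal V$ of finite codimension. -/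

import Mathlib

open MeasureTheory Set
open scoped ContDiff

noncomputable section

namespace NeuralODE

/-- The state space `ℝⁿ` with its Euclidean norm. -/
abbrev Vec (n : ℕ) : Type := EuclideanSpace ℝ (Fin n)

/-- The Banach space of controls `L^∞([0,1], ℝ^p)`. -/
abbrev Control (p : ℕ) : Type := Lp (Vec p) ⊤ (volume.restrict (Icc (0 : ℝ) 1))

/-! ### Geometry of subsets of a normed space -/

section Geometry

variable {W : Type*} [NormedAddCommGroup W] [NormedSpace ℝ W]

/-- `M` is a (smooth, embedded) submanifold of codimension `k` of the normed space `W`: around each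
of its points there is a smooth chart `Φ` of `W` that flattens `M` to a closed linear subspace `F`
of codimension `k` (such a subspace is automatically complemented). -/
def IsSubmanifoldOfCodim (M : Set W) (k : ℕ) : Prop :=
  ∀ u ∈ M, ∃ (F : Submodule ℝ W) (Φ : OpenPartialHomeomorph W W),
    IsClosed (F : Set W) ∧ FiniteDimensional ℝ (W ⧸ F) ∧ Module.finrank ℝ (W ⧸ F) = k ∧
    u ∈ Φ.source ∧ ContDiffOn ℝ ∞ Φ Φ.source ∧ ContDiffOn ℝ ∞ Φ.symm Φ.target ∧
    ∀ w ∈ Φ.source, w ∈ M ↔ Φ w ∈ F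

/-- The tangent space of `M` at `u`: the linear span of the velocities at `u` of curves that lie in
`M`. (For a submanifold these velocities already form a linear subspace.) -/
def tangentSpaceAt (M : Set W) (u : W) : Submodule ℝ W :=
  Submodule.span ℝ {v | ∃ γ : ℝ → W, γ 0 = u ∧ (∀ᶠ t in nhds (0 : ℝ), γ t ∈ M) ∧ HasDerivAt γ v 0}

/-- The sets `M i` intersect transversally: at every common point, each tangent space together with
the intersection of all the other ones spans the ambient space. For two sets this is
`T_u M₁ + T_u M₂ = W`. -/
def IntersectTransversally {ι : Type*} (M : ι → Set W) : Prop :=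
  ∀ u ∈ ⋂ i, M i, ∀ i,
    tangentSpaceAt (M i) u ⊔ (⨅ (k : ι) (_ : k ≠ i), tangentSpaceAt (M k) u) = ⊤

/-- The Lie algebra of vector fields generated by a family `𝓕` of vector fields on `W`. -/
inductive LieGenerated (𝓕 : Set (W → W)) : (W → W) → Prop
  | base (X : W → W) : X ∈ 𝓕 → LieGenerated 𝓕 X
  | add (X Y : W → W) : LieGenerated 𝓕 X → LieGenerated 𝓕 Y → LieGenerated 𝓕 (X + Y)
  | smul (c : ℝ) (X : W → W) : LieGenerated 𝓕 X → LieGenerated 𝓕 (c • X)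
  | bracket (X Y : W → W) : LieGenerated 𝓕 X → LieGenerated 𝓕 Y →
      LieGenerated 𝓕 (VectorField.lieBracket ℝ X Y)

/-- The family `𝓕` is bracket-generating on `Ω`: at every point of `Ω` the values of the fields in
the Lie algebra that it generates are all of `W`. -/
def BracketGeneratingOn (𝓕 : Set (W → W)) (Ω : Set W) : Prop :=
  ∀ x ∈ Ω, ∀ v : W, ∃ X : W → W, LieGenerated 𝓕 X ∧ X x = v

end Geometry

/-! ### The control system `ẋ = f(x, u)` -/

section System

variable {m p o : ℕ}

/-- `x` is a (Carathéodory) solution on `[0,1]` of `ẋ(t) = f(x(t), u(t))`, `x(0) = x₀`. -/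
def IsTrajectory (f : Vec m → Vec p → Vec m) (u : Control p) (x₀ : Vec m) (x : ℝ → Vec m) : Prop :=
  ContinuousOn x (Icc 0 1) ∧
    ∀ t ∈ Icc (0 : ℝ) 1, x t = x₀ + ∫ s in (0 : ℝ)..t, f (x s) (u s)

/-- The flow of the system is defined on `[0,1]` for all controls and all initial states. -/
def HasGlobalFlow (f : Vec m → Vec p → Vec m) : Prop :=
  ∀ (u : Control p) (x₀ : Vec m), ∃ x : ℝ → Vec m, IsTrajectory f u x₀ x

/-- `U(x₀, y)`: the controls that steer `x₀` at time `1` into `R⁻¹(y)`. -/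
def controlSet (f : Vec m → Vec p → Vec m) (R : Vec m →L[ℝ] Vec o) (x₀ : Vec m) (y : Vec o) :
    Set (Control p) :=
  {u | ∃ x : ℝ → Vec m, IsTrajectory f u x₀ x ∧ R (x 1) = y}

/-- `z` solves on `[0,1]` the linearization of the system along the pair `(x, u)` with input `v`,
`ż(t) = ∂f/∂x (x(t), u(t)) z(t) + ∂f/∂u (x(t), u(t)) v(t)`, `z(0) = z₀`. -/
def IsLinearizedTrajectory (f : Vec m → Vec p → Vec m) (u : Control p) (x : ℝ → Vec m)
    (v : Control p) (z₀ : Vec m) (z : ℝ → Vec m) : Prop :=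
  ContinuousOn z (Icc 0 1) ∧
    ∀ t ∈ Icc (0 : ℝ) 1, z t = z₀ + ∫ s in (0 : ℝ)..t,
      (fderiv ℝ (fun a => f a (u s)) (x s) (z s) + fderiv ℝ (fun b => f (x s) b) (u s) (v s))

/-- The linearization along `(x, u)` is controllable on `[0,1]`. -/
def LinearizationControllable (f : Vec m → Vec p → Vec m) (u : Control p) (x : ℝ → Vec m) : Prop :=
  ∀ z₀ z₁ : Vec m, ∃ (v : Control p) (z : ℝ → Vec m),
    IsLinearizedTrajectory f u x v z₀ z ∧ z 1 = z₁

/-- The linearized controllability property at `x₀` with target `y`: for all `u ∈ U(x₀, y)` the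
linearization along the trajectory of `u` that starts at `x₀` is controllable. -/
def LinearizedControllabilityAt (f : Vec m → Vec p → Vec m) (R : Vec m →L[ℝ] Vec o)
    (x₀ : Vec m) (y : Vec o) : Prop :=
  ∀ u ∈ controlSet f R x₀ y, ∀ x : ℝ → Vec m, IsTrajectory f u x₀ x →
    LinearizationControllable f u x

/-- The strong memorization property for an ensemble: the control sets have a common point, and
they intersect transversally. -/
def StrongMemorization (f : Vec m → Vec p → Vec m) (R : Vec m →L[ℝ] Vec o) {q : ℕ}
    (x : Fin q → Vec m) (y : Fin q → Vec o) : Prop :=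
  (⋂ i, controlSet f R (x i) (y i)).Nonempty ∧
    IntersectTransversally fun i => controlSet f R (x i) (y i)

/-- The strong memorization property of degree `q`: it holds for all ensembles of `q` pairwise
distinct initial states with arbitrary targets. -/
def StrongMemorizationOfDegree (f : Vec m → Vec p → Vec m) (R : Vec m →L[ℝ] Vec o) (q : ℕ) :
    Prop :=
  ∀ (x : Fin q → Vec m) (y : Fin q → Vec o), Function.Injective x → StrongMemorization f R x y

/-- The vector fields `(x₁, …, x_q) ↦ (f(x₁, a), …, f(x_q, a))`, `a ∈ ℝ^p`, of the `q`-folded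
system. -/
def foldedFields (f : Vec m → Vec p → Vec m) (q : ℕ) : Set ((Fin q → Vec m) → (Fin q → Vec m)) :=
  {X | ∃ a : Vec p, X = fun x i => f (x i) a}

/-- The `q`-folded system is bracket-generating on the set of `q`-tuples of pairwise distinct
states. -/
def FoldedBracketGenerating (f : Vec m → Vec p → Vec m) (q : ℕ) : Prop :=
  BracketGeneratingOn (foldedFields f q) {x : Fin q → Vec m | Function.Injective x}

end System

end NeuralODE

end

/-! Write `H i u = R (φ(u, E (x i)))`. The set in question is a level set of `G = (H i)_{i < j}`, a
map from `L^∞` to a finite-dimensional space, so it suffices that `G` is smooth and that its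
derivative is onto at each point of the level set.

Smoothness: a trajectory is a zero of `x - x₀ - V N(u, x)` in `L^∞`, with `V` the Volterra operator
and `N` the superposition by `f`. Superposition is smooth on `L^∞`. The partial derivative in `x` is
the identity minus a Volterra operator with bounded kernel, whose powers decay factorially, so it is
invertible. The implicit function theorem gives local smooth branches, and uniqueness of
trajectories identifies them with the global solution map (`contDiff_solution`).

Surjectivity: by (A2) each single `dH i` with `i < j` is onto (`surjective_fderiv_endpoint`). To get
them jointly onto, use (A3) at the targets `H k u`, `k < q`: then `u` lies in all `q` control sets,
although it was only known to lie in the first `j`. Tangent spaces sit inside the kernels of `dH k`,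
so transversality passes to the kernels, and dropping the indices `≥ j` only enlarges the
intersection. -/

noncomputable section

namespace NeuralODE

/-! ### Level sets of submersions -/

/-- Velocities of curves in a level set lie in the kernel of the derivative. -/
theorem tangentSpaceAt_le_ker {W Y : Type*} [NormedAddCommGroup W] [NormedSpace ℝ W]
    [NormedAddCommGroup Y] [NormedSpace ℝ Y] {M : Set W} {G : W → Y} {G' : W →L[ℝ] Y} {u : W} {y : Y}
    (hM : ∀ w ∈ M, G w = y) (hG : HasFDerivAt G G' u) : tangentSpaceAt M u ≤ G'.ker := by
  refine Submodule.span_le.2 ?_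
  rintro v ⟨γ, h0, hγ, hv⟩
  subst h0
  have h1 : HasDerivAt (G ∘ γ) (G' v) 0 := hG.comp_hasDerivAt 0 hv
  have h2 : HasDerivAt (G ∘ γ) 0 0 :=
    (hasDerivAt_const (0 : ℝ) y).congr_of_eventuallyEq (hγ.mono fun t ht => hM _ ht)
  exact h1.unique h2

section Submersion

variable {W Y : Type*} [NormedAddCommGroup W] [NormedSpace ℝ W] [CompleteSpace W]
  [NormedAddCommGroup Y] [NormedSpace ℝ Y] [FiniteDimensional ℝ Y]

/-- A smooth map whose derivative at `u` is invertible restricts to a smooth diffeomorphism between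
open sets. -/
theorem exists_openPartialHomeomorph_of_contDiff {Ψ : W → W} (hΨ : ContDiff ℝ ∞ Ψ) {u : W}
    {e : W ≃L[ℝ] W} (he : HasFDerivAt Ψ (e : W →L[ℝ] W) u) :
    ∃ Φ : OpenPartialHomeomorph W W, u ∈ Φ.source ∧ (Φ : W → W) = Ψ ∧
      ContDiffOn ℝ ∞ Φ Φ.source ∧ ContDiffOn ℝ ∞ Φ.symm Φ.target := by
  have hne : (∞ : WithTop ℕ∞) ≠ 0 := by simp
  let Φ₀ := hΨ.contDiffAt.toOpenPartialHomeomorph Ψ he hne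
  -- The inverse function theorem yields smoothness of the inverse only at the image of `u`;
  -- shrinking to the open set where the derivative is invertible gives it on the whole target.
  have hopen : IsOpen {w : W | fderiv ℝ Ψ w ∈ range ((↑) : (W ≃L[ℝ] W) → W →L[ℝ] W)} :=
    ContinuousLinearEquiv.isOpen.preimage (hΨ.continuous_fderiv hne)
  let Φ := Φ₀.restrOpen _ hopen
  have hsource : Φ.source = Φ₀.source ∩ {w : W | fderiv ℝ Ψ w ∈ range _} :=
    Φ₀.restrOpen_source _ hopen
  have hcoe : (Φ : W → W) = Ψ := rfl
  refine ⟨Φ, ?_, hcoe, ?_, ?_⟩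
  · rw [hsource]
    exact ⟨hΨ.contDiffAt.mem_toOpenPartialHomeomorph_source he hne, e, he.fderiv.symm⟩
  · rw [hcoe]; exact hΨ.contDiffOn
  · intro a ha
    have hmem := Φ.map_target ha
    rw [hsource] at hmem
    obtain ⟨e', he'⟩ := hmem.2
    refine (Φ.contDiffAt_symm (f₀' := e') ha ?_ ?_).contDiffWithinAt
    · rw [he', hcoe]
      exact (hΨ.differentiable hne).differentiableAt.hasFDerivAt
    · rw [hcoe]; exact hΨ.contDiffAt

/-- A level set of a smooth map into a finite-dimensional space along which the derivative is
surjective is a submanifold, of codimension the dimension of the target. -/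
theorem isSubmanifoldOfCodim_preimage_singleton {G : W → Y} (hG : ContDiff ℝ ∞ G) (y : Y)
    (hsurj : ∀ u, G u = y → Function.Surjective (fderiv ℝ G u)) :
    IsSubmanifoldOfCodim {u | G u = y} (Module.finrank ℝ Y) := by
  intro u hu
  set L := fderiv ℝ G u with hL
  obtain ⟨S, hS⟩ := L.exists_rightInverse_of_surjective (LinearMap.range_eq_top.2 (hsurj u hu))
  have hLS : ∀ a, L (S a) = a := fun a => congrArg (fun T : Y →L[ℝ] Y => T a) hS
  -- Since `L ∘ S = id`, `L (Ψ w) = G w - y`, so `Ψ` carries the level set into `L.ker` exactly. Its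
  -- derivative at `u` is `id + S (L - L) = id`.
  let Ψ : W → W := fun w => w + S (G w - y - L w)
  have hΨ : ContDiff ℝ ∞ Ψ := by fun_prop
  have hne : (∞ : WithTop ℕ∞) ≠ 0 := by simp
  have hd : HasFDerivAt Ψ ((ContinuousLinearEquiv.refl ℝ W : W ≃L[ℝ] W) : W →L[ℝ] W) u := by
    have h1 : HasFDerivAt G L u := (hG.differentiable hne).differentiableAt.hasFDerivAt
    have h2 := (hasFDerivAt_id (𝕜 := ℝ) u).add
      (S.hasFDerivAt.comp u ((h1.sub_const y).sub L.hasFDerivAt))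
    convert h2 using 1
    · funext w; rfl
    · ext w; simp
  obtain ⟨Φ, hmem, hcoe, hs, hs'⟩ := exists_openPartialHomeomorph_of_contDiff hΨ hd
  let q : (W ⧸ L.ker) ≃ₗ[ℝ] Y := (L : W →ₗ[ℝ] Y).quotKerEquivOfSurjective (hsurj u hu)
  refine ⟨L.ker, Φ, L.isClosed_ker, q.symm.finiteDimensional, q.finrank_eq, hmem, hs, hs', ?_⟩
  intro w _
  rw [hcoe]
  simp only [Ψ, mem_ofPred_eq, LinearMap.mem_ker, ContinuousLinearMap.coe_coe, map_add, hLS]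
  rw [add_sub_cancel, sub_eq_zero]

end Submersion

/-! ### Superposition operators on `L^∞` -/

section Superposition

variable {α : Type*} [MeasurableSpace α] {μ : Measure α}

theorem ae_norm_le_norm {E : Type*} [NormedAddCommGroup E] (w : Lp E ⊤ μ) :
    ∀ᵐ t ∂μ, ‖w t‖ ≤ ‖w‖ := by
  have h := ae_le_eLpNormEssSup (f := w) (μ := μ)
  filter_upwards [h] with t ht
  rw [Lp.norm_def, eLpNorm_exponent_top, ← toReal_enorm]
  exact ENNReal.toReal_mono (by simpa using (Lp.memLp w).2.ne) ht

theorem norm_le_of_ae_norm_le [IsFiniteMeasure μ] {E : Type*} [NormedAddCommGroup E]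
    {w : Lp E ⊤ μ} {C : ℝ} (hC : 0 ≤ C) (h : ∀ᵐ t ∂μ, ‖w t‖ ≤ C) : ‖w‖ ≤ C := by
  simpa using Lp.norm_le_of_ae_bound hC h

/-- Pointwise application of an `L^∞` field of operators, as a continuous bilinear map. -/
def pointwiseApply (μ : Measure α) (E F : Type) [NormedAddCommGroup E] [NormedSpace ℝ E]
    [NormedAddCommGroup F] [NormedSpace ℝ F] :
    Lp (E →L[ℝ] F) ⊤ μ →L[ℝ] Lp E ⊤ μ →L[ℝ] Lp F ⊤ μ :=
  (ContinuousLinearMap.id ℝ (E →L[ℝ] F)).holderL μ ⊤ ⊤ ⊤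

theorem coeFn_pointwiseApply {E F : Type} [NormedAddCommGroup E] [NormedSpace ℝ E]
    [NormedAddCommGroup F] [NormedSpace ℝ F] (A : Lp (E →L[ℝ] F) ⊤ μ) (w : Lp E ⊤ μ) :
    pointwiseApply μ E F A w =ᵐ[μ] fun t => A t (w t) :=
  ContinuousLinearMap.coeFn_holder _ A w

variable {E : Type} [NormedAddCommGroup E] [ProperSpace E] {F : Type} [NormedAddCommGroup F]

theorem memLp_top_comp {g : E → F} (hg : Continuous g) (w : Lp E ⊤ μ) :
    MemLp (fun t => g (w t)) ⊤ μ := by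
  obtain ⟨C, hC⟩ := (isCompact_closedBall (0 : E) ‖w‖).exists_bound_of_continuousOn hg.continuousOn
  refine memLp_top_of_bound (hg.comp_aestronglyMeasurable (Lp.aestronglyMeasurable w)) C ?_
  filter_upwards [ae_norm_le_norm w] with t ht
  exact hC _ (by simpa using ht)

/-- The superposition operator `w ↦ g ∘ w` on `L^∞`. -/
def superposition {g : E → F} (hg : Continuous g) (w : Lp E ⊤ μ) : Lp F ⊤ μ :=
  (memLp_top_comp hg w).toLp

theorem coeFn_superposition {g : E → F} (hg : Continuous g) (w : Lp E ⊤ μ) :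
    superposition hg w =ᵐ[μ] fun t => g (w t) :=
  MemLp.coeFn_toLp _

variable [NormedSpace ℝ E] [NormedSpace ℝ F] [IsFiniteMeasure μ]

/-- The sup norm confines almost all values of `w` and `w + h` to one compact ball, on which `g'` is
uniformly continuous. The mean value inequality then bounds the linearization error by `c * ‖h t‖`
with the same `δ` for almost every `t`. -/
theorem hasFDerivAt_superposition {g : E → F} (hg : Continuous g) (hd : Differentiable ℝ g)
    (hg' : Continuous (fderiv ℝ g)) (w : Lp E ⊤ μ) :
    HasFDerivAt (superposition hg) (pointwiseApply μ E F (superposition hg' w)) w := by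
  rw [hasFDerivAt_iff_isLittleO_nhds_zero, Asymptotics.isLittleO_iff]
  intro c hc
  have huc := (isCompact_closedBall (0 : E) (‖w‖ + 1)).uniformContinuousOn_of_continuous
    hg'.continuousOn
  obtain ⟨δ, hδ, H⟩ := Metric.uniformContinuousOn_iff_le.1 huc c hc
  filter_upwards [Metric.ball_mem_nhds (0 : Lp E ⊤ μ) (lt_min hδ one_pos)] with h hh
  have hh' : ‖h‖ < min δ 1 := by simpa using hh
  have h1 : ‖h‖ ≤ δ := (hh'.trans_le (min_le_left _ _)).le
  have h2 : ‖h‖ ≤ 1 := (hh'.trans_le (min_le_right _ _)).le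
  refine norm_le_of_ae_norm_le (by positivity) ?_
  filter_upwards [ae_norm_le_norm w, ae_norm_le_norm h, coeFn_superposition hg w,
    coeFn_superposition hg (w + h), coeFn_superposition hg' w, Lp.coeFn_add w h,
    coeFn_pointwiseApply (superposition hg' w) h,
    Lp.coeFn_sub (superposition hg (w + h)) (superposition hg w),
    Lp.coeFn_sub (superposition hg (w + h) - superposition hg w)
      (pointwiseApply μ E F (superposition hg' w) h)] with t e1 e2 e3 e4 e5 e6 e7 e8 e9
  rw [e9, Pi.sub_apply, e8, Pi.sub_apply, e7, e5, e4, e3, e6, Pi.add_apply]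
  -- The first ball is the domain of uniform continuity; the second keeps every point within `δ` of
  -- `w t`.
  let s := Metric.closedBall (0 : E) (‖w‖ + 1) ∩ Metric.closedBall (w t) ‖h t‖
  have hs : Convex ℝ s := (convex_closedBall _ _).inter (convex_closedBall _ _)
  have key := hs.norm_image_sub_le_of_norm_fderiv_le' (f := g) (φ := fderiv ℝ g (w t)) (C := c)
    (x := w t) (y := w t + h t) (fun x _ => hd x) ?_ ?_ ?_
  · rw [add_sub_cancel_left] at key
    exact key.trans (by gcongr)
  · intro x hx
    rw [← dist_eq_norm]
    refine H x hx.1 (w t) ?_ ?_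
    · simpa using by linarith
    · exact (Metric.mem_closedBall.1 hx.2).trans (e2.trans h1)
  · refine ⟨?_, by simp⟩
    simpa using by linarith
  · refine ⟨?_, by simp⟩
    simpa using (norm_add_le _ _).trans (by linarith)

/-- The derivative is superposition by `g'` followed by a fixed continuous linear map, so regularity
bootstraps. The codomain changes from `F` to `E →L[ℝ] F`, hence the induction generalizes `F`. -/
theorem contDiff_superposition {g : E → F} (hg : Continuous g) (h : ContDiff ℝ ∞ g) :
    ContDiff ℝ ∞ (superposition (μ := μ) hg) := by
  refine contDiff_infty.2 fun n => ?_
  induction n generalizing F with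
  | zero =>
    have hd := contDiff_infty_iff_fderiv.1 h
    exact contDiff_zero.2 (continuous_iff_continuousAt.2 fun w =>
      (hasFDerivAt_superposition hg hd.1 hd.2.continuous w).continuousAt)
  | succ n ih =>
    have hd := contDiff_infty_iff_fderiv.1 h
    have hder := fun w : Lp E ⊤ μ => hasFDerivAt_superposition hg hd.1 hd.2.continuous w
    push_cast
    refine contDiff_succ_iff_fderiv.2 ⟨fun w => (hder w).differentiableAt, by simp, ?_⟩
    have hfd : fderiv ℝ (superposition (μ := μ) hg) =
        fun w => pointwiseApply μ E F (superposition hd.2.continuous w) :=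
      funext fun w => (hder w).fderiv
    rw [hfd]
    exact (pointwiseApply μ E F).contDiff.comp (ih _ hd.2)

end Superposition

/-! ### The Volterra operator on `L^∞([0,1])` -/

section Volterra

variable {E : Type} [NormedAddCommGroup E]

theorem intervalIntegrable_of_mem_Icc (w : Lp E ⊤ (volume.restrict (Icc (0 : ℝ) 1))) {t : ℝ}
    (ht : t ∈ Icc (0 : ℝ) 1) : IntervalIntegrable w volume 0 t := by
  have h : IntegrableOn w (Icc (0 : ℝ) 1) volume := (Lp.memLp w).integrable le_top
  rw [intervalIntegrable_iff_integrableOn_Icc_of_le ht.1]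
  exact h.mono_set (Icc_subset_Icc_right ht.2)

/-- An almost everywhere property on `[0,1]` holds almost everywhere on `(0,t]`. -/
theorem ae_uIoc_of_ae_Icc {P : ℝ → Prop} (h : ∀ᵐ s ∂volume.restrict (Icc (0 : ℝ) 1), P s) {t : ℝ}
    (ht : t ∈ Icc (0 : ℝ) 1) : ∀ᵐ s, s ∈ Ioc (0 : ℝ) t → P s := by
  filter_upwards [(ae_restrict_iff' measurableSet_Icc).1 h] with s hs hst
  exact hs ⟨hst.1.le, hst.2.trans ht.2⟩

theorem ae_mem_Icc : ∀ᵐ s ∂volume.restrict (Icc (0 : ℝ) 1), s ∈ Icc (0 : ℝ) 1 :=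
  ae_restrict_mem measurableSet_Icc

theorem memLp_top_of_continuousOn {x : ℝ → E} (hx : ContinuousOn x (Icc 0 1)) :
    MemLp x ⊤ (volume.restrict (Icc (0 : ℝ) 1)) := by
  obtain ⟨C, hC⟩ := isCompact_Icc.exists_bound_of_continuousOn hx
  refine memLp_top_of_bound (hx.aestronglyMeasurable measurableSet_Icc) C ?_
  filter_upwards [ae_mem_Icc] with t ht using hC t ht

variable [NormedSpace ℝ E]

theorem integral_congr_of_ae_Icc {g h : ℝ → E}
    (hgh : g =ᵐ[volume.restrict (Icc (0 : ℝ) 1)] h) {t : ℝ} (ht : t ∈ Icc (0 : ℝ) 1) :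
    ∫ s in (0 : ℝ)..t, g s = ∫ s in (0 : ℝ)..t, h s := by
  refine intervalIntegral.integral_congr_ae ?_
  rw [uIoc_of_le ht.1]
  exact ae_uIoc_of_ae_Icc hgh ht

theorem continuousOn_integral_Icc (w : Lp E ⊤ (volume.restrict (Icc (0 : ℝ) 1))) :
    ContinuousOn (fun t => ∫ s in (0 : ℝ)..t, w s) (Icc 0 1) := by
  have h : IntegrableOn w (Icc (0 : ℝ) 1) volume := (Lp.memLp w).integrable le_top
  exact intervalIntegral.continuousOn_primitive h |>.congr
    fun t ht => intervalIntegral.integral_of_le ht.1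

theorem norm_integral_Icc_le (w : Lp E ⊤ (volume.restrict (Icc (0 : ℝ) 1))) {t : ℝ}
    (ht : t ∈ Icc (0 : ℝ) 1) : ‖∫ s in (0 : ℝ)..t, w s‖ ≤ ‖w‖ := by
  have h := intervalIntegral.norm_integral_le_of_norm_le_const_ae (a := 0) (b := t) (C := ‖w‖)
    (f := w) (by rw [uIoc_of_le ht.1]; exact ae_uIoc_of_ae_Icc (ae_norm_le_norm w) ht)
  rw [sub_zero, abs_of_nonneg ht.1] at h
  exact h.trans (mul_le_of_le_one_right (norm_nonneg _) ht.2)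

theorem integral_add_Icc (v w : Lp E ⊤ (volume.restrict (Icc (0 : ℝ) 1))) {t : ℝ}
    (ht : t ∈ Icc (0 : ℝ) 1) :
    ∫ s in (0 : ℝ)..t, (v + w) s = (∫ s in (0 : ℝ)..t, v s) + ∫ s in (0 : ℝ)..t, w s := by
  rw [integral_congr_of_ae_Icc (Lp.coeFn_add v w) ht]
  exact intervalIntegral.integral_add (intervalIntegrable_of_mem_Icc v ht)
    (intervalIntegrable_of_mem_Icc w ht)

theorem integral_smul_Icc (c : ℝ) (w : Lp E ⊤ (volume.restrict (Icc (0 : ℝ) 1))) {t : ℝ}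
    (ht : t ∈ Icc (0 : ℝ) 1) :
    ∫ s in (0 : ℝ)..t, (c • w) s = c • ∫ s in (0 : ℝ)..t, w s := by
  rw [integral_congr_of_ae_Icc (Lp.coeFn_smul c w) ht]
  exact intervalIntegral.integral_smul c w

/-- The integral over `[0,1]` as a continuous linear map on `L^∞([0,1])`. -/
def unitIntegral (E : Type) [NormedAddCommGroup E] [NormedSpace ℝ E] :
    Lp E ⊤ (volume.restrict (Icc (0 : ℝ) 1)) →L[ℝ] E :=
  LinearMap.mkContinuous
    { toFun := fun w => ∫ s in (0 : ℝ)..1, w s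
      map_add' := fun v w => integral_add_Icc v w (right_mem_Icc.2 zero_le_one)
      map_smul' := fun c w => integral_smul_Icc c w (right_mem_Icc.2 zero_le_one) } 1
    fun w => by simpa using norm_integral_Icc_le w (right_mem_Icc.2 zero_le_one)

theorem unitIntegral_apply (w : Lp E ⊤ (volume.restrict (Icc (0 : ℝ) 1))) :
    unitIntegral E w = ∫ s in (0 : ℝ)..1, w s := rfl

/-- The Volterra operator `(volterra w)(t) = ∫₀ᵗ w` on `L^∞([0,1])`. -/
def volterra (E : Type) [NormedAddCommGroup E] [NormedSpace ℝ E] :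
    Lp E ⊤ (volume.restrict (Icc (0 : ℝ) 1)) →L[ℝ] Lp E ⊤ (volume.restrict (Icc (0 : ℝ) 1)) :=
  LinearMap.mkContinuous
    { toFun := fun w => (memLp_top_of_continuousOn (continuousOn_integral_Icc w)).toLp
      map_add' := fun v w => by
        rw [← MemLp.toLp_add]
        refine MemLp.toLp_congr _ _ ?_
        filter_upwards [ae_mem_Icc] with t ht using integral_add_Icc v w ht
      map_smul' := fun c w => by
        rw [RingHom.id_apply, ← MemLp.toLp_const_smul]
        refine MemLp.toLp_congr _ _ ?_
        filter_upwards [ae_mem_Icc] with t ht using integral_smul_Icc c w ht } 1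
    fun w => by
      rw [one_mul]
      refine norm_le_of_ae_norm_le (norm_nonneg w) ?_
      filter_upwards [MemLp.coeFn_toLp (memLp_top_of_continuousOn (continuousOn_integral_Icc w)),
        ae_mem_Icc] with t h1 ht
      exact h1 ▸ norm_integral_Icc_le w ht

theorem coeFn_volterra (w : Lp E ⊤ (volume.restrict (Icc (0 : ℝ) 1))) :
    volterra E w =ᵐ[volume.restrict (Icc (0 : ℝ) 1)] fun t => ∫ s in (0 : ℝ)..t, w s :=
  MemLp.coeFn_toLp (memLp_top_of_continuousOn (continuousOn_integral_Icc w))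

/-- Keeping the weight `t ^ n` pointwise is what produces the factorial; a bound on the sup norm
alone would lose it. -/
theorem ae_norm_volterra_le {w : Lp E ⊤ (volume.restrict (Icc (0 : ℝ) 1))} {C : ℝ} {n : ℕ}
    (h : ∀ᵐ t ∂volume.restrict (Icc (0 : ℝ) 1), ‖w t‖ ≤ C * (t ^ n / n.factorial)) :
    ∀ᵐ t ∂volume.restrict (Icc (0 : ℝ) 1),
      ‖volterra E w t‖ ≤ C * (t ^ (n + 1) / (n + 1).factorial) := by
  filter_upwards [coeFn_volterra w, ae_mem_Icc] with t h1 ht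
  rw [h1]
  refine (intervalIntegral.norm_integral_le_of_norm_le ht.1 (ae_uIoc_of_ae_Icc h ht)
    (Continuous.intervalIntegrable (by fun_prop) _ _)).trans_eq ?_
  rw [intervalIntegral.integral_const_mul, intervalIntegral.integral_div, integral_pow,
    Nat.factorial_succ]
  push_cast
  field_simp
  simp

/-- The iterates of a Volterra operator with a bounded local kernel decay factorially. -/
theorem ae_norm_le_of_volterra_iterate {d c : ℕ → Lp E ⊤ (volume.restrict (Icc (0 : ℝ) 1))} {K : ℝ}
    (hK : 0 ≤ K) (hd : ∀ n, d (n + 1) = volterra E (c n))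
    (hc : ∀ n, ∀ᵐ t ∂volume.restrict (Icc (0 : ℝ) 1), ‖c n t‖ ≤ K * ‖d n t‖) (n : ℕ) :
    ∀ᵐ t ∂volume.restrict (Icc (0 : ℝ) 1), ‖d n t‖ ≤ ‖d 0‖ * K ^ n * (t ^ n / n.factorial) := by
  induction n with
  | zero => simpa using ae_norm_le_norm (d 0)
  | succ n ih =>
    rw [hd]
    refine ae_norm_volterra_le ?_
    filter_upwards [ih, hc n] with t h1 h2
    calc ‖c n t‖ ≤ K * ‖d n t‖ := h2
      _ ≤ K * (‖d 0‖ * K ^ n * (t ^ n / n.factorial)) := by gcongr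
      _ = _ := by ring

theorem norm_le_of_volterra_iterate {d c : ℕ → Lp E ⊤ (volume.restrict (Icc (0 : ℝ) 1))} {K : ℝ}
    (hK : 0 ≤ K) (hd : ∀ n, d (n + 1) = volterra E (c n))
    (hc : ∀ n, ∀ᵐ t ∂volume.restrict (Icc (0 : ℝ) 1), ‖c n t‖ ≤ K * ‖d n t‖) (n : ℕ) :
    ‖d n‖ ≤ K ^ n / n.factorial * ‖d 0‖ := by
  refine norm_le_of_ae_norm_le (by positivity) ?_
  filter_upwards [ae_norm_le_of_volterra_iterate hK hd hc n, ae_mem_Icc] with t h ht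
  calc ‖d n t‖ ≤ ‖d 0‖ * K ^ n * (t ^ n / n.factorial) := h
    _ ≤ ‖d 0‖ * K ^ n * (1 / n.factorial) := by
      gcongr
      exact pow_le_one₀ ht.1 ht.2
    _ = _ := by ring

/-- Grönwall's lemma in `L^∞`. -/
theorem eq_zero_of_eq_volterra {d c : Lp E ⊤ (volume.restrict (Icc (0 : ℝ) 1))} {K : ℝ}
    (hK : 0 ≤ K) (hd : d = volterra E c)
    (hc : ∀ᵐ t ∂volume.restrict (Icc (0 : ℝ) 1), ‖c t‖ ≤ K * ‖d t‖) : d = 0 := by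
  -- A solution of the homogeneous equation is its own iterate, so the constant sequence satisfies
  -- the factorial bound for every `n`.
  have h := fun n => norm_le_of_volterra_iterate (d := fun _ => d) (c := fun _ => c) hK
    (fun _ => hd) (fun _ => hc) n
  have hlim := (FloorSemiring.tendsto_pow_div_factorial_atTop K).mul_const ‖d‖
  rw [zero_mul] at hlim
  exact norm_le_zero_iff.1 (ge_of_tendsto' hlim h)

/-- The operator `T` may have norm above `1`, but some power has norm below `1`. Then `1 - T ^ n` is
invertible, and it is a product of `1 - T` with a commuting factor, so `1 - T` is invertible too. -/
theorem isUnit_one_sub_volterra_comp [CompleteSpace E]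
    {B : Lp E ⊤ (volume.restrict (Icc (0 : ℝ) 1)) →L[ℝ] Lp E ⊤ (volume.restrict (Icc (0 : ℝ) 1))}
    {K : ℝ} (hK : 0 ≤ K)
    (hB : ∀ h, ∀ᵐ t ∂volume.restrict (Icc (0 : ℝ) 1), ‖B h t‖ ≤ K * ‖h t‖) :
    IsUnit (1 - volterra E ∘L B) := by
  set T := volterra E ∘L B with hT
  have hpow : ∀ n : ℕ, ‖T ^ n‖ ≤ K ^ n / n.factorial := fun n =>
    ContinuousLinearMap.opNorm_le_bound _ (by positivity) fun h => by
      refine norm_le_of_volterra_iterate (d := fun k => (T ^ k) h) (c := fun k => B ((T ^ k) h)) hK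
        (fun k => ?_) (fun k => hB _) n
      rw [pow_succ']; rfl
  obtain ⟨n, hn⟩ := ((FloorSemiring.tendsto_pow_div_factorial_atTop K).eventually
    (gt_mem_nhds one_pos)).exists
  have hu : IsUnit (1 - T ^ n) := isUnit_one_sub_of_norm_lt_one ((hpow n).trans_lt hn)
  have hcomm : Commute (1 - T) (∑ i ∈ Finset.range n, T ^ i) :=
    (Commute.one_left _).sub_left (Commute.sum_right _ _ _ fun i _ => Commute.self_pow T i)
  rw [← mul_neg_geom_sum T n] at hu
  exact (hcomm.isUnit_mul_iff.1 hu).1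

end Volterra

/-! ### Smoothness of the endpoint map -/

section Endpoint

variable {m p : ℕ}

/-- The control and state functions `u`, `x` combined into the function `t ↦ (x t, u t)`. -/
def pairing (m p : ℕ) : Control p × Control m →L[ℝ]
    Lp (Vec m × Vec p) ⊤ (volume.restrict (Icc (0 : ℝ) 1)) :=
  (ContinuousLinearMap.compLpL ⊤ _ (ContinuousLinearMap.inr ℝ (Vec m) (Vec p))).comp
      (ContinuousLinearMap.fst ℝ _ _) +
    (ContinuousLinearMap.compLpL ⊤ _ (ContinuousLinearMap.inl ℝ (Vec m) (Vec p))).comp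
      (ContinuousLinearMap.snd ℝ _ _)

theorem coeFn_pairing (u : Control p) (X : Control m) :
    pairing m p (u, X) =ᵐ[volume.restrict (Icc (0 : ℝ) 1)] fun t => (X t, u t) := by
  filter_upwards [Lp.coeFn_add
    (ContinuousLinearMap.compLpL ⊤ _ (ContinuousLinearMap.inr ℝ (Vec m) (Vec p)) u)
    (ContinuousLinearMap.compLpL ⊤ _ (ContinuousLinearMap.inl ℝ (Vec m) (Vec p)) X),
    ContinuousLinearMap.coeFn_compLp (ContinuousLinearMap.inr ℝ (Vec m) (Vec p)) u,
    ContinuousLinearMap.coeFn_compLp (ContinuousLinearMap.inl ℝ (Vec m) (Vec p)) X] with t h1 h2 h3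
  refine h1.trans ?_
  rw [Pi.add_apply]
  erw [h2, h3]
  simp

variable {f : Vec m → Vec p → Vec m}

/-- The velocity `t ↦ f (x t) (u t)` as an element of `L^∞`. -/
def velocity (hf : ContDiff ℝ ∞ fun z : Vec m × Vec p => f z.1 z.2) (w : Control p × Control m) :
    Control m :=
  superposition hf.continuous (pairing m p w)

variable (hf : ContDiff ℝ ∞ fun z : Vec m × Vec p => f z.1 z.2)

theorem coeFn_velocity (u : Control p) (X : Control m) :
    velocity hf (u, X) =ᵐ[volume.restrict (Icc (0 : ℝ) 1)] fun t => f (X t) (u t) := by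
  filter_upwards [coeFn_superposition hf.continuous (pairing m p (u, X)), coeFn_pairing u X]
    with t h1 h2
  rw [velocity, h1, h2]

/-- The linearization of the velocity along `w = (u, x)`. -/
def velocityDeriv (w : Control p × Control m) : Control p × Control m →L[ℝ] Control m :=
  (pointwiseApply _ _ _
    (superposition (contDiff_infty_iff_fderiv.1 hf).2.continuous (pairing m p w))).comp
    (pairing m p)

theorem coeFn_velocityDeriv (u v : Control p) (X Z : Control m) :
    velocityDeriv hf (u, X) (v, Z) =ᵐ[volume.restrict (Icc (0 : ℝ) 1)] fun t =>
      fderiv ℝ (fun z : Vec m × Vec p => f z.1 z.2) (X t, u t) (Z t, v t) := by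
  filter_upwards [coeFn_superposition (contDiff_infty_iff_fderiv.1 hf).2.continuous
    (pairing m p (u, X)), coeFn_pairing u X, coeFn_pairing v Z, coeFn_pointwiseApply
    (superposition (contDiff_infty_iff_fderiv.1 hf).2.continuous (pairing m p (u, X)))
    (pairing m p (v, Z))] with t h1 h2 h3 h4
  refine h4.trans ?_
  rw [h1, h2, h3]

theorem hasFDerivAt_velocity (w : Control p × Control m) :
    HasFDerivAt (velocity hf) (velocityDeriv hf w) w :=
  (hasFDerivAt_superposition hf.continuous (contDiff_infty_iff_fderiv.1 hf).1
    (contDiff_infty_iff_fderiv.1 hf).2.continuous _).comp w (pairing m p).hasFDerivAt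

theorem contDiff_velocity : ContDiff ℝ ∞ (velocity hf) :=
  (contDiff_superposition hf.continuous hf).comp (pairing m p).contDiff

/-- The bound must hold pointwise in `t`, not just in norm, to feed the factorial decay of Volterra
iterates. -/
theorem exists_ae_norm_velocityDeriv_le (w : Control p × Control m) :
    ∃ K : ℝ, 0 ≤ K ∧ ∀ Z : Control m, ∀ᵐ t ∂volume.restrict (Icc (0 : ℝ) 1),
      ‖velocityDeriv hf w (0, Z) t‖ ≤ K * ‖Z t‖ := by
  set D := superposition (contDiff_infty_iff_fderiv.1 hf).2.continuous (pairing m p w) with hD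
  refine ⟨‖D‖, norm_nonneg _, fun Z => ?_⟩
  filter_upwards [ae_norm_le_norm D, coeFn_pairing (0 : Control p) Z,
    coeFn_pointwiseApply D (pairing m p (0, Z)),
    Lp.coeFn_zero (Vec p) ⊤ (volume.restrict (Icc (0 : ℝ) 1))] with t h1 h2 h3 h4
  have h5 : velocityDeriv hf w (0, Z) t = D t (pairing m p (0, Z) t) := h3
  rw [h5, h2, h4]
  refine ((D t).le_opNorm _).trans ?_
  rw [Prod.norm_def]
  simp only [Pi.zero_apply, norm_zero, norm_nonneg, sup_of_le_left]
  gcongr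

/-- The defect of the integral equation; it vanishes when `x` is the trajectory of `u` that starts
at `x₀`. -/
def defect (x₀ : Vec m) (w : Control p × Control m) : Control m :=
  w.2 - Lp.const ⊤ _ x₀ - volterra (Vec m) (velocity hf w)

theorem contDiff_defect (x₀ : Vec m) : ContDiff ℝ ∞ (defect hf x₀) :=
  (contDiff_snd.sub contDiff_const).sub ((volterra (Vec m)).contDiff.comp (contDiff_velocity hf))

theorem hasFDerivAt_defect (x₀ : Vec m) (w : Control p × Control m) :
    HasFDerivAt (defect hf x₀)
      (ContinuousLinearMap.snd ℝ _ _ - volterra (Vec m) ∘L velocityDeriv hf w) w :=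
  (hasFDerivAt_snd.sub_const _).sub
    ((volterra (Vec m)).hasFDerivAt.comp w (hasFDerivAt_velocity hf w))

theorem isInvertible_fderiv_defect (x₀ : Vec m) (w : Control p × Control m) :
    (fderiv ℝ (defect hf x₀) w ∘L .inr ℝ (Control p) (Control m)).IsInvertible := by
  obtain ⟨K, hK, h⟩ := exists_ae_norm_velocityDeriv_le hf w
  have hu := isUnit_one_sub_volterra_comp
    (B := velocityDeriv hf w ∘L .inr ℝ (Control p) (Control m)) hK h
  rw [(hasFDerivAt_defect hf x₀ w).fderiv]
  refine ⟨ContinuousLinearEquiv.unitsEquiv ℝ _ hu.unit, ?_⟩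
  ext1 Z
  rfl

theorem defect_eq_zero_iff (x₀ : Vec m) (u : Control p) (X : Control m) :
    defect hf x₀ (u, X) = 0 ↔ X = Lp.const ⊤ _ x₀ + volterra (Vec m) (velocity hf (u, X)) := by
  rw [defect, sub_sub, sub_eq_zero]

/-- No global Lipschitz bound on `f` is needed: `X`, `Y` and `u` are essentially bounded, and `f` is
Lipschitz on a ball containing their values. The constant may depend on all three. -/
theorem exists_ae_norm_velocity_sub_le (u : Control p) (X Y : Control m) :
    ∃ K : ℝ, 0 ≤ K ∧ ∀ᵐ t ∂volume.restrict (Icc (0 : ℝ) 1),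
      ‖(velocity hf (u, X) - velocity hf (u, Y)) t‖ ≤ K * ‖(X - Y) t‖ := by
  have hd := contDiff_infty_iff_fderiv.1 hf
  obtain ⟨K, hK⟩ := (isCompact_closedBall (0 : Vec m × Vec p)
    (max (max ‖X‖ ‖Y‖) ‖u‖)).exists_bound_of_continuousOn hd.2.continuous.continuousOn
  refine ⟨max K 0, le_max_right _ _, ?_⟩
  filter_upwards [coeFn_velocity hf u X, coeFn_velocity hf u Y, ae_norm_le_norm X,
    ae_norm_le_norm Y, ae_norm_le_norm u, Lp.coeFn_sub X Y,
    Lp.coeFn_sub (velocity hf (u, X)) (velocity hf (u, Y))] with t h1 h2 h3 h4 h5 h6 h7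
  rw [h7, h6, Pi.sub_apply, Pi.sub_apply, h1, h2]
  have key := (convex_closedBall (0 : Vec m × Vec p)
    (max (max ‖X‖ ‖Y‖) ‖u‖)).norm_image_sub_le_of_norm_fderiv_le (C := max K 0)
    (x := (Y t, u t)) (y := (X t, u t)) (fun z _ => hd.1 z)
    (fun z hz => (hK z hz).trans (le_max_left _ _))
    (mem_closedBall_zero_iff.2 (max_le_max (h4.trans (le_max_right _ _)) h5))
    (mem_closedBall_zero_iff.2 (max_le_max (h3.trans (le_max_left _ _)) h5))
  simpa [Prod.norm_def] using key

theorem eq_of_defect_eq_zero {x₀ : Vec m} {u : Control p} {X Y : Control m}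
    (hX : defect hf x₀ (u, X) = 0) (hY : defect hf x₀ (u, Y) = 0) : X = Y := by
  rw [defect_eq_zero_iff] at hX hY
  obtain ⟨K, hK, h⟩ := exists_ae_norm_velocity_sub_le hf u X Y
  refine sub_eq_zero.1 (eq_zero_of_eq_volterra hK ?_ h)
  conv_lhs => rw [hX, hY]
  rw [map_sub, add_sub_add_left_eq_sub]

/-- A trajectory defines a zero of the defect. -/
theorem IsTrajectory.exists_defect_eq_zero {u : Control p} {x₀ : Vec m} {x : ℝ → Vec m}
    (hx : IsTrajectory f u x₀ x) : ∃ X : Control m,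
      X =ᵐ[volume.restrict (Icc (0 : ℝ) 1)] x ∧ defect hf x₀ (u, X) = 0 ∧
      x 1 = x₀ + unitIntegral (Vec m) (velocity hf (u, X)) := by
  have hX := (memLp_top_of_continuousOn hx.1).coeFn_toLp
  set X : Control m := (memLp_top_of_continuousOn hx.1).toLp
  have hv : velocity hf (u, X) =ᵐ[volume.restrict (Icc (0 : ℝ) 1)] fun t => f (x t) (u t) := by
    filter_upwards [coeFn_velocity hf u X, hX] with t h1 h2
    rw [h1, h2]
  refine ⟨X, hX, (defect_eq_zero_iff hf x₀ u X).2 (Lp.ext ?_), ?_⟩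
  · filter_upwards [hX, Lp.coeFn_add (Lp.const ⊤ _ x₀) (volterra (Vec m) (velocity hf (u, X))),
      Lp.coeFn_const (p := ⊤) (μ := volume.restrict (Icc (0 : ℝ) 1)) x₀,
      coeFn_volterra (velocity hf (u, X)), ae_mem_Icc] with t h1 h2 h3 h4 ht
    rw [h1, h2, Pi.add_apply, h3, h4, hx.2 t ht, integral_congr_of_ae_Icc hv ht,
      Function.const_apply]
  · rw [unitIntegral_apply, integral_congr_of_ae_Icc hv (right_mem_Icc.2 zero_le_one)]
    exact hx.2 1 (right_mem_Icc.2 zero_le_one)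

theorem exists_solution (hflow : HasGlobalFlow f) (x₀ : Vec m) (u : Control p) :
    ∃ X : Control m, defect hf x₀ (u, X) = 0 :=
  let ⟨_, hx⟩ := hflow u x₀
  let ⟨X, _, hX, _⟩ := hx.exists_defect_eq_zero hf
  ⟨X, hX⟩

variable (hflow : HasGlobalFlow f)

/-- The control-to-trajectory map. -/
def solution (x₀ : Vec m) (u : Control p) : Control m :=
  (exists_solution hf hflow x₀ u).choose

theorem defect_solution (x₀ : Vec m) (u : Control p) :
    defect hf x₀ (u, solution hf hflow x₀ u) = 0 :=
  (exists_solution hf hflow x₀ u).choose_spec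

/-- Near `u` the implicit function is a smooth branch of zeros of the defect; uniqueness of the zero
for each control forces it to agree with the chosen solution. -/
theorem contDiff_solution (x₀ : Vec m) : ContDiff ℝ ∞ (solution hf hflow x₀) := by
  refine contDiff_iff_contDiffAt.2 fun u => ?_
  have hne : (∞ : WithTop ℕ∞) ≠ 0 := by simp
  have hc : ContDiffAt ℝ ∞ (defect hf x₀) (u, solution hf hflow x₀ u) :=
    (contDiff_defect hf x₀).contDiffAt
  have hinv := isInvertible_fderiv_defect hf x₀ (u, solution hf hflow x₀ u)
  refine (hc.contDiffAt_implicitFunction hne hinv).congr_of_eventuallyEq ?_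
  filter_upwards [hc.eventually_apply_implicitFunction hne hinv] with v hv
  exact eq_of_defect_eq_zero hf (defect_solution hf hflow x₀ v)
    (hv.trans (defect_solution hf hflow x₀ u))

/-- The endpoint map `u ↦ φ(u, x₀)`. -/
def endpoint (x₀ : Vec m) (u : Control p) : Vec m :=
  x₀ + unitIntegral (Vec m) (velocity hf (u, solution hf hflow x₀ u))

theorem contDiff_endpoint (x₀ : Vec m) : ContDiff ℝ ∞ (endpoint hf hflow x₀) :=
  contDiff_const.add ((unitIntegral (Vec m)).contDiff.comp
    ((contDiff_velocity hf).comp (contDiff_id.prodMk (contDiff_solution hf hflow x₀))))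

theorem IsTrajectory.solution_ae_eq {u : Control p} {x₀ : Vec m} {x : ℝ → Vec m}
    (hx : IsTrajectory f u x₀ x) :
    solution hf hflow x₀ u =ᵐ[volume.restrict (Icc (0 : ℝ) 1)] x := by
  obtain ⟨X, hXx, hX, -⟩ := hx.exists_defect_eq_zero hf
  rwa [eq_of_defect_eq_zero hf (defect_solution hf hflow x₀ u) hX]

theorem IsTrajectory.apply_one_eq {u : Control p} {x₀ : Vec m} {x : ℝ → Vec m}
    (hx : IsTrajectory f u x₀ x) : x 1 = endpoint hf hflow x₀ u := by
  obtain ⟨X, -, hX, h1⟩ := hx.exists_defect_eq_zero hf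
  rw [h1, eq_of_defect_eq_zero hf hX (defect_solution hf hflow x₀ u), endpoint]

theorem mem_controlSet_iff {o : ℕ} {R : Vec m →L[ℝ] Vec o} {x₀ : Vec m} {y : Vec o}
    {u : Control p} : u ∈ controlSet f R x₀ y ↔ R (endpoint hf hflow x₀ u) = y := by
  constructor
  · rintro ⟨x, hx, hy⟩
    rwa [← hx.apply_one_eq hf hflow]
  · intro h
    obtain ⟨x, hx⟩ := hflow u x₀
    exact ⟨x, hx, by rwa [hx.apply_one_eq hf hflow]⟩

/-- The derivative of the endpoint map is the endpoint of the linearized equation. -/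
theorem fderiv_endpoint_apply {u v : Control p} {x₀ : Vec m} {x z : ℝ → Vec m}
    (hx : IsTrajectory f u x₀ x) (hz : IsLinearizedTrajectory f u x v 0 z) :
    fderiv ℝ (endpoint hf hflow x₀) u v = z 1 := by
  have hne : (∞ : WithTop ℕ∞) ≠ 0 := by simp
  set X := solution hf hflow x₀ u with hXdef
  have hs : HasFDerivAt (solution hf hflow x₀) (fderiv ℝ (solution hf hflow x₀) u) u :=
    ((contDiff_solution hf hflow x₀).differentiable hne).differentiableAt.hasFDerivAt
  set ζ := fderiv ℝ (solution hf hflow x₀) u v with hζ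
  have hN : HasFDerivAt (fun u => velocity hf (u, solution hf hflow x₀ u))
      (velocityDeriv hf (u, X) ∘L
        (ContinuousLinearMap.id ℝ _).prod (fderiv ℝ (solution hf hflow x₀) u)) u :=
    HasFDerivAt.comp (g := velocity hf) (f := fun u => (u, solution hf hflow x₀ u)) u
      (hasFDerivAt_velocity hf (u, X)) ((hasFDerivAt_id u).prodMk hs)
  -- Differentiating the integral equation of the solution in direction `v` gives a linear Volterra
  -- equation; `Z` satisfies the same one, so Grönwall gives `Z = ζ`.
  have hζeq : ζ = volterra (Vec m) (velocityDeriv hf (u, X) (v, ζ)) := by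
    have h1 : solution hf hflow x₀ = fun u => Lp.const ⊤ _ x₀ +
        volterra (Vec m) (velocity hf (u, solution hf hflow x₀ u)) :=
      funext fun u => (defect_eq_zero_iff hf x₀ u _).1 (defect_solution hf hflow x₀ u)
    have h2 := ((volterra (Vec m)).hasFDerivAt.comp u hN).const_add (Lp.const ⊤ _ x₀)
    have h3 := hs.unique (h2.congr_of_eventuallyEq (Filter.Eventually.of_forall (congrFun h1)))
    exact congrArg (fun T => T v) h3
  have hend : fderiv ℝ (endpoint hf hflow x₀) u v =
      unitIntegral (Vec m) (velocityDeriv hf (u, X) (v, ζ)) := by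
    have h2 := ((unitIntegral (Vec m)).hasFDerivAt.comp u hN).const_add x₀
    exact congrArg (fun T => T v) h2.fderiv
  have hZ := (memLp_top_of_continuousOn hz.1).coeFn_toLp
  set Z : Control m := (memLp_top_of_continuousOn hz.1).toLp
  have hint : velocityDeriv hf (u, X) (v, Z) =ᵐ[volume.restrict (Icc (0 : ℝ) 1)] fun s =>
      fderiv ℝ (fun a => f a (u s)) (x s) (z s) + fderiv ℝ (fun b => f (x s) b) (u s) (v s) := by
    filter_upwards [coeFn_velocityDeriv hf u v X Z, hZ, hx.solution_ae_eq hf hflow]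
      with s h1 h2 h3
    rw [h1, h2, ← hXdef] at *
    rw [h3]
    have hd := (contDiff_infty_iff_fderiv.1 hf).1 (x s, u s)
    have ha : fderiv ℝ (fun a => f a (u s)) (x s) = _ :=
      (HasFDerivAt.comp (g := fun z : Vec m × Vec p => f z.1 z.2) (x s) hd.hasFDerivAt
        (hasFDerivAt_prodMk_left (𝕜 := ℝ) (x s) (u s))).fderiv
    have hb : fderiv ℝ (fun b => f (x s) b) (u s) = _ :=
      (HasFDerivAt.comp (g := fun z : Vec m × Vec p => f z.1 z.2) (u s) hd.hasFDerivAt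
        (hasFDerivAt_prodMk_right (𝕜 := ℝ) (x s) (u s))).fderiv
    rw [ha, hb]
    simp [← map_add]
  have hZeq : Z = volterra (Vec m) (velocityDeriv hf (u, X) (v, Z)) := by
    refine Lp.ext ?_
    filter_upwards [hZ, coeFn_volterra (velocityDeriv hf (u, X) (v, Z)), ae_mem_Icc]
      with t h1 h2 ht
    rw [h1, h2, hz.2 t ht, integral_congr_of_ae_Icc hint ht, zero_add]
  have hzero : Z - ζ = 0 := by
    obtain ⟨K, hK, h⟩ := exists_ae_norm_velocityDeriv_le hf (u, X)
    refine eq_zero_of_eq_volterra hK ?_ (h (Z - ζ))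
    conv_lhs => rw [hZeq, hζeq]
    rw [← map_sub, ← map_sub, Prod.mk_sub_mk, sub_self]
  rw [hend, ← sub_eq_zero.1 hzero, unitIntegral_apply,
    integral_congr_of_ae_Icc hint (right_mem_Icc.2 zero_le_one),
    hz.2 1 (right_mem_Icc.2 zero_le_one), zero_add]

theorem surjective_fderiv_endpoint {u : Control p} {x₀ : Vec m} {x : ℝ → Vec m}
    (hx : IsTrajectory f u x₀ x) (hc : LinearizationControllable f u x) :
    Function.Surjective (fderiv ℝ (endpoint hf hflow x₀) u) := fun z₁ =>
  let ⟨v, _, hz, hz₁⟩ := hc 0 z₁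
  ⟨v, (fderiv_endpoint_apply hf hflow hx hz).trans hz₁⟩

end Endpoint

/-! ### Jointly surjective families of linear maps -/

/-- A finite family of surjective linear maps is jointly surjective if each kernel together with the
intersection of the other ones spans the space. -/
theorem surjective_pi_of_ker_sup_iInf_ker {ι W : Type*} [Fintype ι] [DecidableEq ι]
    [AddCommGroup W] [Module ℝ W] {Y : ι → Type*} [∀ i, AddCommGroup (Y i)] [∀ i, Module ℝ (Y i)]
    (L : ∀ i, W →ₗ[ℝ] Y i) (hL : ∀ i, Function.Surjective (L i))
    (h : ∀ i, (L i).ker ⊔ (⨅ (k : ι) (_ : k ≠ i), (L k).ker) = ⊤) :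
    Function.Surjective (LinearMap.pi L) := by
  intro y
  have hex : ∀ i, ∃ b : W, L i b = y i ∧ ∀ k, k ≠ i → L k b = 0 := fun i => by
    obtain ⟨v, hv⟩ := hL i (y i)
    -- Splitting off the part in the kernel of `L i` leaves `b` with the same value under `L i` and
    -- value `0` under every other `L k`; summing these over `i` solves the joint problem.
    obtain ⟨a, ha, b, hb, rfl⟩ := Submodule.mem_sup.1 (h i ▸ Submodule.mem_top : v ∈ _)
    refine ⟨b, ?_, fun k hk => ?_⟩
    · rw [← hv, map_add, LinearMap.mem_ker.1 ha, zero_add]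
    · simp only [Submodule.mem_iInf] at hb
      exact hb k hk
  choose b hb hb' using hex
  refine ⟨∑ i, b i, funext fun k => ?_⟩
  rw [LinearMap.pi_apply, map_sum, Finset.sum_eq_single k (fun i _ hi => hb' i k hi.symm) (by simp)]
  exact hb k

end NeuralODE

end

/-! ### The intersection of control sets as a regular level set -/

theorem theorem1 {n m p o q : ℕ}
    (f : NeuralODE.Vec m → NeuralODE.Vec p → NeuralODE.Vec m)
    (hf : ContDiff ℝ ∞ fun z : NeuralODE.Vec m × NeuralODE.Vec p => f z.1 z.2)
    (hflow : NeuralODE.HasGlobalFlow f)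
    (R : NeuralODE.Vec m →L[ℝ] NeuralODE.Vec o)
    (hRsurj : Function.Surjective R) (hRlip : LipschitzWith 1 R)
    (E : NeuralODE.Vec n → NeuralODE.Vec m)
    (hEcont : Continuous E) (hEinj : Function.Injective E)
    (x : Fin q → NeuralODE.Vec n) (y : Fin q → NeuralODE.Vec o) (hx : Function.Injective x)
    (hbracket : NeuralODE.FoldedBracketGenerating f q)
    (hlcp : ∀ i, NeuralODE.LinearizedControllabilityAt f R (E (x i)) (y i))
    (hsmp : NeuralODE.StrongMemorizationOfDegree f R q) :
    ∀ j : ℕ, 1 ≤ j → j ≤ q → ∃ k : ℕ, NeuralODE.IsSubmanifoldOfCodim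
      (⋂ (i : Fin q) (_ : (i : ℕ) < j), NeuralODE.controlSet f R (E (x i)) (y i)) k := by
  intro j _ _
  let ι := {i : Fin q // (i : ℕ) < j}
  let H : Fin q → NeuralODE.Control p → NeuralODE.Vec o := fun i u =>
    R (NeuralODE.endpoint hf hflow (E (x i)) u)
  have hne : (∞ : WithTop ℕ∞) ≠ 0 := by simp
  have hH : ∀ i, ContDiff ℝ ∞ (H i) := fun i =>
    R.contDiff.comp (NeuralODE.contDiff_endpoint hf hflow _)
  have hmem : ∀ (i : Fin q) (w : NeuralODE.Vec o) (u : NeuralODE.Control p),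
      u ∈ NeuralODE.controlSet f R (E (x i)) w ↔ H i u = w := fun i w u =>
    NeuralODE.mem_controlSet_iff hf hflow
  have hH' : ∀ i u, HasFDerivAt (H i) (fderiv ℝ (H i) u) u := fun i u =>
    ((hH i).differentiable hne).differentiableAt.hasFDerivAt
  let G : NeuralODE.Control p → ι → NeuralODE.Vec o := fun u i => H i u
  have hset : (⋂ (i : Fin q) (_ : (i : ℕ) < j), NeuralODE.controlSet f R (E (x i)) (y i)) =
      {u | G u = fun i : ι => y i} := by
    ext u
    simp only [mem_iInter, mem_ofPred_eq, funext_iff, hmem]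
    exact ⟨fun h i => h i i.2, fun h i hi => h ⟨i, hi⟩⟩
  have hG : ContDiff ℝ ∞ G := contDiff_pi.2 fun i : ι => hH i
  rw [hset]
  -- The codimension is the dimension of `ι → Vec o`, that is `j * o`.
  refine ⟨_, NeuralODE.isSubmanifoldOfCodim_preimage_singleton hG _ ?_⟩
  intro u hu
  have hGder : fderiv ℝ G u = ContinuousLinearMap.pi fun i : ι => fderiv ℝ (H i) u :=
    (hasFDerivAt_pi.2 fun i : ι => hH' i u).fderiv
  rw [hGder]
  refine NeuralODE.surjective_pi_of_ker_sup_iInf_ker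
    (fun i : ι => (fderiv ℝ (H i) u : NeuralODE.Control p →ₗ[ℝ] NeuralODE.Vec o))
    (fun i => ?_) fun i => ?_
  · obtain ⟨ξ, hξ⟩ := hflow u (E (x i))
    have hderiv : fderiv ℝ (H i) u =
        R ∘L fderiv ℝ (NeuralODE.endpoint hf hflow (E (x i))) u :=
      (R.hasFDerivAt.comp u ((NeuralODE.contDiff_endpoint hf hflow _).differentiable
        hne).differentiableAt.hasFDerivAt).fderiv
    rw [hderiv]
    exact hRsurj.comp (NeuralODE.surjective_fderiv_endpoint hf hflow hξ
      (hlcp i u ((hmem i _ u).2 (congrFun hu i)) ξ hξ))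
  · -- Strong memorization is applied with the outputs of `u` itself as targets.
    have htrans := (hsmp (fun k => E (x k)) (fun k => H k u) (hEinj.comp hx)).2 u
      (mem_iInter.2 fun k => (hmem k _ u).2 rfl) i
    have hle : ∀ k, NeuralODE.tangentSpaceAt (NeuralODE.controlSet f R (E (x k)) (H k u)) u ≤
        (fderiv ℝ (H k) u).ker := fun k =>
      NeuralODE.tangentSpaceAt_le_ker (fun w hw => (hmem k _ w).1 hw) (hH' k u)
    refine top_le_iff.1 (htrans.symm.le.trans (sup_le_sup (hle i) ?_))
    -- The infimum over all `q` indices lies below each term with index in `ι`, and each such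
    -- tangent space lies in its kernel.
    refine le_iInf fun k => le_iInf fun hk => (iInf₂_le (k : Fin q) ?_).trans (hle k)
    exact fun h => hk (Subtype.ext h)
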